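/- Call a positive, even, continuous function $p$ on $(-1,1)$ a Nehari function if $(1-x^2)^2p(x)$ is non-increasing on $[0,1)$ and the equation $u''+pu=0$ has no nontrivial solution with more than one zero in $(-1,1)$; call it extremal if, in addition, $kp$ is not a Nehari function for any $k>1$. For a Nehari function $p$ let $u_0$ be the solution of $u''+pu=0$ on $(-1,1)$ with $u_0(0)=1$, $u_0'(0)=0$, put $\Phi(x)=\int_0^x u_0(t)^{-2}\,dt$ for $-1<x<1$, and let $\mathbf g_\Phi=\Phi'(|z|)^2|dz|^2$ be the associated radial metric on the unit disk $\mathbb D$. Let $\phi=(f_1,\dots,f_n):\mathbb D\to\mathbb C^n$ be holomorphic with $\phi'\neq0$ on $\mathbb D$. Put $\sigma=\tfrac12\log(|f_1'|^2+\cdots+|f_n'|^2)$, let $\mathcal S\phi=2(\sigma_{zz}-\sigma_z^2)$ be its Schwarzian derivative, and let $K(\phi(z))=-e^{-2\sigma(z)}\Delta\sigma(z)$ be the Gaussian curvature of the surface $\phi(\mathbb D)$ at $\phi(z)$. Theorem. Suppose that for an extremal Nehari function $p$ $$|\mathcal S\phi(z)|+\tfrac34|\phi'(z)|^2|K(\phi(z))|\le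 2p(|z|),\qquad z\in\mathbb D.$$ Then $w(z)=\sqrt{\Phi'(|z|)/|\phi'(z)|}$ is a $C^2$ function on $\mathbb D$ which satisfies $$\operatorname{Hess}_{\mathbf g_\Phi}(w)\ \ge\ \tfrac18\,w^{-3}\,|K(\phi)|\,\mathbf g_\Phi\qquad\text{on }\mathbb D,$$ where $K(\phi)$ is the function $z\mapsto K(\phi(z))$. In particular, $w$ is convex relative to $\mathbf g_\Phi$, in the sense that $\operatorname{Hess}_{\mathbf g_\Phi}(w)\ge\alpha\,\mathbf g_\Phi$ for some nonnegative function $\alpha$. -/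

import Mathlib

open Set Metric
open scoped MatrixOrder

namespace HolCurve

/-! ### Nehari functions -/

/-- `u` is a solution of `u'' + p u = 0` on `(-1,1)`. -/
def IsODESolution (p u : ℝ → ℝ) : Prop :=
  ∀ x ∈ Ioo (-1 : ℝ) 1,
    HasDerivAt u (deriv u x) x ∧ HasDerivAt (deriv u) (-(p x * u x)) x

/-- Nehari functions: positive, even, continuous on `(-1,1)`, with `(1-x²)² p(x)` non-increasing on
`[0,1)`, and such that no nontrivial solution of `u'' + p u = 0` has more than one zero in
`(-1,1)`. -/
structure IsNehari (p : ℝ → ℝ) : Prop where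
  pos : ∀ x ∈ Ioo (-1 : ℝ) 1, 0 < p x
  even : ∀ x ∈ Ioo (-1 : ℝ) 1, p (-x) = p x
  cont : ContinuousOn p (Ioo (-1) 1)
  anti : AntitoneOn (fun x : ℝ => (1 - x ^ 2) ^ 2 * p x) (Ico 0 1)
  disconj : ∀ u : ℝ → ℝ, IsODESolution p u → (∃ x ∈ Ioo (-1 : ℝ) 1, u x ≠ 0) →
    {x | x ∈ Ioo (-1 : ℝ) 1 ∧ u x = 0}.Subsingleton

/-- Extremal Nehari functions: `k p` is not a Nehari function for any `k > 1`. -/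
def IsExtremalNehari (p : ℝ → ℝ) : Prop :=
  IsNehari p ∧ ∀ k : ℝ, 1 < k → ¬ IsNehari (fun x => k * p x)

/-- `u₀` is the solution of `u'' + p u = 0` on `(-1,1)` with `u(0) = 1`, `u'(0) = 0`. -/
def IsInitialSolution (p u₀ : ℝ → ℝ) : Prop :=
  IsODESolution p u₀ ∧ u₀ 0 = 1 ∧ deriv u₀ 0 = 0

/-- The extremal function `Φ(x) = ∫₀ˣ u₀(t)⁻² dt`. -/
noncomputable def extremalFun (u₀ : ℝ → ℝ) (x : ℝ) : ℝ :=
  ∫ t in (0 : ℝ)..x, (u₀ t ^ 2)⁻¹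

/-! ### Holomorphic curves in `ℂⁿ` -/

/-- `∂f/∂z = (1/2) (∂f/∂x - i ∂f/∂y)`. -/
noncomputable def dz (f : ℂ → ℂ) (z : ℂ) : ℂ :=
  (1 / 2) * (fderiv ℝ f z 1 - Complex.I * fderiv ℝ f z Complex.I)

/-- `σ = (1/2) log (|f₁'|² + ⋯ + |fₙ'|²)` for `φ = (f₁, …, fₙ)`. -/
noncomputable def sigma {n : ℕ} (φ : ℂ → EuclideanSpace ℂ (Fin n)) (z : ℂ) : ℝ :=
  (1 / 2) * Real.log (∑ k, ‖deriv φ z k‖ ^ 2)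

/-- The Schwarzian derivative `2 (σ_zz - σ_z²)` of a holomorphic curve. -/
noncomputable def schwarzian {n : ℕ} (φ : ℂ → EuclideanSpace ℂ (Fin n)) (z : ℂ) : ℂ :=
  2 * (dz (dz (fun ζ => (sigma φ ζ : ℂ))) z - dz (fun ζ => (sigma φ ζ : ℂ)) z ^ 2)

/-- The Gaussian curvature `K(φ(z)) = -e^{-2σ} Δσ` of the surface `φ(𝔻)` at `φ(z)`. -/
noncomputable def gaussCurv {n : ℕ} (φ : ℂ → EuclideanSpace ℂ (Fin n)) (z : ℂ) : ℝ :=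
  -Real.exp (-2 * sigma φ z) * Laplacian.laplacian (sigma φ) z

/-- The injectivity criterion `|Sφ(z)| + (3/4) |φ'(z)|² |K(φ(z))| ≤ 2 p(|z|)` on the disk. -/
def SatisfiesCriterion {n : ℕ} (φ : ℂ → EuclideanSpace ℂ (Fin n)) (p : ℝ → ℝ) : Prop :=
  ∀ z ∈ ball (0 : ℂ) 1,
    ‖schwarzian φ z‖ + 3 / 4 * ‖deriv φ z‖ ^ 2 * |gaussCurv φ z| ≤ 2 * p ‖z‖

/-! ### Riemannian Hessian in the Cartesian coordinates `x, y` of the plane -/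

/-- Partial derivatives: `∂₀ = ∂/∂x`, `∂₁ = ∂/∂y`. -/
noncomputable def pd (i : Fin 2) (f : ℂ → ℝ) (z : ℂ) : ℝ :=
  fderiv ℝ f z (![1, Complex.I] i)

/-- Christoffel symbols
`Γᵏᵢⱼ = (1/2) ∑ₗ gᵏˡ (∂ᵢ gⱼₗ + ∂ⱼ gᵢₗ - ∂ₗ gᵢⱼ)` of the metric `g`. -/
noncomputable def christoffel (g : ℂ → Matrix (Fin 2) (Fin 2) ℝ) (k i j : Fin 2) (z : ℂ) : ℝ :=
  (1 / 2) * ∑ l, (g z)⁻¹ k l *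
    (pd i (fun ζ => g ζ j l) z + pd j (fun ζ => g ζ i l) z - pd l (fun ζ => g ζ i j) z)

/-- The Hessian `(Hess_g f)ᵢⱼ = ∂ᵢ∂ⱼ f - ∑ₖ Γᵏᵢⱼ ∂ₖ f` of `f` with respect to the metric `g`. -/
noncomputable def hess (g : ℂ → Matrix (Fin 2) (Fin 2) ℝ) (f : ℂ → ℝ) (z : ℂ) :
    Matrix (Fin 2) (Fin 2) ℝ :=
  Matrix.of fun i j => pd i (pd j f) z - ∑ k, christoffel g k i j z * pd k f z

/-- `f` is convex relative to the metric `g` on `U`: `f` is `C²` and `Hess_g f ≥ α g` for a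
nonnegative function `α`. Here `≤` on matrices is the Loewner order of symmetric bilinear forms. -/
def ConvexRel (g : ℂ → Matrix (Fin 2) (Fin 2) ℝ) (f : ℂ → ℝ) (U : Set ℂ) : Prop :=
  ContDiffOn ℝ 2 f U ∧ ∃ α : ℂ → ℝ, ∀ z ∈ U, 0 ≤ α z ∧ α z • g z ≤ hess g f z

/-- The radial metric `Φ'(|z|)² |dz|²`. -/
noncomputable def radialMetric (Φ : ℝ → ℝ) (z : ℂ) : Matrix (Fin 2) (Fin 2) ℝ :=
  (deriv Φ ‖z‖ ^ 2) • (1 : Matrix (Fin 2) (Fin 2) ℝ)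

/-- The function `w(z) = √(Φ'(|z|) / |φ'(z)|)`. -/
noncomputable def wFun {n : ℕ} (Φ : ℝ → ℝ) (φ : ℂ → EuclideanSpace ℂ (Fin n)) (z : ℂ) : ℝ :=
  Real.sqrt (deriv Φ ‖z‖ / ‖deriv φ z‖)

end HolCurve

/-! Write Φ'(|z|) = e^ρ with ρ = -2 log u₀(|z|), so that g_Φ = e^{2ρ}|dz|² and w = e^τ with τ =
(ρ-σ)/2. Let S(f) = 2(f_zz - f_z²). The trace-free part of Hess w, read as a complex number, is e^τ
(S(ρ) - S(σ) - (τ_x - iτ_y)²), and its Euclidean trace is e^τ (Δτ + |∇τ|²). A symmetric 2×2 matrix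
is bounded below once its trace dominates its trace-free part. The triangle inequality cancels
|∇τ|², and `le_hess_exp` reduces the claim to |S(ρ) - S(σ)| + 2β ≤ (Δρ - Δσ)/2.

Put y = -u₀'/u₀, so y' = p + y². On |z| = r > 0, Δρ/2 = y² + y/r + p and |S(ρ)| = |y² + y/r - p|. If
p ≤ y² + y/r, then |S(ρ)| + 2p = Δρ/2, and the criterion yields the required bound
(`IsExtremalNehari.schwarz_compare`).

The inequality p ≤ y² + y/r (`IsExtremalNehari.le_riccati`) is where extremality enters. The
function η = (1-x²)y - x satisfies η(0) = 0 and (1-x²)η' = (1-x²)²p - 1 + η². If η were negative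
somewhere on [0,1), a strict Riccati subsolution for kp with some k > 1 could be glued together,
making kp a Nehari function (`IsNehari.exists_mul_of_neg`). So η ≥ 0, and the monotonicity of
(1-x²)²p does the rest. -/

namespace HolCurve

/-! ### Linear second order equations on `(-1,1)` -/

/-- Uniqueness for the Cauchy problem of `u'' + q u = 0` on `(-1,1)`. -/
theorem linear_ode_unique {q u u' v v' : ℝ → ℝ} (hq : ContinuousOn q (Ioo (-1) 1))
    (hu : ∀ x ∈ Ioo (-1 : ℝ) 1, HasDerivAt u (u' x) x ∧ HasDerivAt u' (-(q x * u x)) x)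
    (hv : ∀ x ∈ Ioo (-1 : ℝ) 1, HasDerivAt v (v' x) x ∧ HasDerivAt v' (-(q x * v x)) x)
    {c : ℝ} (hc : c ∈ Ioo (-1 : ℝ) 1) (h0 : u c = v c) (h1 : u' c = v' c) :
    ∀ x ∈ Ioo (-1 : ℝ) 1, u x = v x := by
  intro x hx
  obtain ⟨d, hd, hd1⟩ := exists_between (max_lt (abs_lt.2 hc) (abs_lt.2 hx))
  have hcd : c ∈ Ioo (-d) d := abs_lt.1 ((le_max_left _ _).trans_lt hd)
  have hxd : x ∈ Ioo (-d) d := abs_lt.1 ((le_max_right _ _).trans_lt hd)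
  have hsub : Icc (-d) d ⊆ Ioo (-1 : ℝ) 1 := fun t ht => ⟨by linarith [ht.1], by linarith [ht.2]⟩
  obtain ⟨M, hM⟩ := isCompact_Icc.exists_bound_of_continuousOn (hq.mono hsub)
  have hM0 : 0 ≤ M := (norm_nonneg _).trans (hM c ⟨hcd.1.le, hcd.2.le⟩)
  -- Since q may blow up at ±1, the first-order system for (u, u') is considered on (-d, d) only. In
  -- the sup norm its Lipschitz constant there is max(1, sup |q|).
  have key := ODE_solution_unique_of_mem_Ioo (E := ℝ × ℝ)
    (v := fun t w => (w.2, -(q t * w.1))) (s := fun _ => univ) (K := ⟨max 1 M, by positivity⟩)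
    (f := fun t => (u t, u' t)) (g := fun t => (v t, v' t)) (a := -d) (b := d) (t₀ := c)
    ?_ hcd ?_ ?_ (by simp [h0, h1])
  · exact congrArg Prod.fst (key hxd)
  · intro t ht
    refine LipschitzOnWith.of_dist_le_mul fun w _ w' _ => ?_
    have hMt : |q t| ≤ M := hM t ⟨ht.1.le, ht.2.le⟩
    simp only [Prod.dist_eq, Real.dist_eq]
    change _ ≤ max 1 M * _
    have e : |-(q t * w.1) - -(q t * w'.1)| = |q t| * |w.1 - w'.1| := by
      rw [← abs_mul, ← abs_neg]; ring_nf
    rw [e]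
    have h1 : (1 : ℝ) ≤ max 1 M := le_max_left _ _
    have h2 : M ≤ max 1 M := le_max_right _ _
    apply max_le
    · calc |w.2 - w'.2| ≤ 1 * max |w.1 - w'.1| |w.2 - w'.2| := by
            rw [one_mul]; exact le_max_right _ _
        _ ≤ _ := by gcongr
    · exact mul_le_mul (hMt.trans h2) (le_max_left _ _) (abs_nonneg _) (by positivity)
  · exact fun t ht => ⟨(hu t (hsub ⟨ht.1.le, ht.2.le⟩)).1.prodMk
      (hu t (hsub ⟨ht.1.le, ht.2.le⟩)).2, mem_univ _⟩
  · exact fun t ht => ⟨(hv t (hsub ⟨ht.1.le, ht.2.le⟩)).1.prodMk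
      (hv t (hsub ⟨ht.1.le, ht.2.le⟩)).2, mem_univ _⟩

/-- A solution with vanishing Cauchy data at a point vanishes identically. -/
theorem IsODESolution.eq_zero {q u : ℝ → ℝ} (hq : ContinuousOn q (Ioo (-1) 1))
    (hu : IsODESolution q u) {c : ℝ} (hc : c ∈ Ioo (-1 : ℝ) 1) (h0 : u c = 0)
    (h1 : deriv u c = 0) : ∀ x ∈ Ioo (-1 : ℝ) 1, u x = 0 :=
  linear_ode_unique (v := fun _ => 0) (v' := fun _ => 0) hq hu
    (fun x _ => ⟨hasDerivAt_const x 0, by simpa using hasDerivAt_const x (0 : ℝ)⟩) hc h0 h1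

/-- For a Riccati subsolution `m' > q + m²` the quantity `u u' + m u²` is strictly increasing along
a nontrivial solution of `u'' + q u = 0`. -/
theorem riccati_strict_mono {q u m m' : ℝ → ℝ} (hq : ContinuousOn q (Ioo (-1) 1))
    (hu : IsODESolution q u) (hne : ∃ x ∈ Ioo (-1 : ℝ) 1, u x ≠ 0) {s t : ℝ} (hst : s < t)
    (hs : -1 < s) (ht : t < 1) (hm : ∀ x ∈ Icc s t, HasDerivAt m (m' x) x)
    (hlt : ∀ x ∈ Icc s t, q x + m x ^ 2 < m' x) :
    u s * deriv u s + m s * u s ^ 2 < u t * deriv u t + m t * u t ^ 2 := by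
  have hI : ∀ x ∈ Icc s t, x ∈ Ioo (-1 : ℝ) 1 := fun x hx =>
    ⟨hs.trans_le hx.1, hx.2.trans_lt ht⟩
  have hE : ∀ x ∈ Icc s t, HasDerivAt (fun x => u x * deriv u x + m x * u x ^ 2)
      ((deriv u x + m x * u x) ^ 2 + (m' x - (q x + m x ^ 2)) * u x ^ 2) x := by
    intro x hx
    obtain ⟨h1, h2⟩ := hu x (hI x hx)
    have := (h1.mul h2).add ((hm x hx).mul (h1.pow 2))
    refine this.congr_deriv ?_
    simp; ring
  have hmono : StrictMonoOn (fun x => u x * deriv u x + m x * u x ^ 2) (Icc s t) := by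
    refine strictMonoOn_of_deriv_pos (convex_Icc s t)
      (fun x hx => (hE x hx).continuousAt.continuousWithinAt) fun x hx => ?_
    replace hx := interior_subset hx
    rw [(hE x hx).deriv]
    have h3 := hlt x hx
    -- At a zero of u, uniqueness forces u' ≠ 0 and the square is positive; elsewhere the strict
    -- Riccati gap is.
    by_cases hux : u x = 0
    · have : deriv u x ≠ 0 := by
        intro h
        obtain ⟨y, hy, hy'⟩ := hne
        exact hy' (hu.eq_zero hq (hI x hx) hux h y hy)
      rw [hux]
      simpa using pow_pos (abs_pos.2 this) 2
    · have : 0 < u x ^ 2 := by positivity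
      have := mul_pos (sub_pos.2 h3) this
      positivity
  exact hmono (left_mem_Icc.2 hst.le) (right_mem_Icc.2 hst.le) hst

/-- Disconjugacy from a piecewise smooth strict Riccati subsolution with upward jumps at `±c`. -/
theorem disconj_of_riccati {q u m₁ m₂ m₃ m₁' m₂' m₃' : ℝ → ℝ} {c : ℝ} (hc : 0 ≤ c)
    (hq : ContinuousOn q (Ioo (-1) 1)) (hu : IsODESolution q u)
    (hne : ∃ x ∈ Ioo (-1 : ℝ) 1, u x ≠ 0)
    (hm₁ : ∀ x ∈ Ioc (-1) (-c), HasDerivAt m₁ (m₁' x) x ∧ q x + m₁ x ^ 2 < m₁' x)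
    (hm₂ : ∀ x ∈ Icc (-c) c, HasDerivAt m₂ (m₂' x) x ∧ q x + m₂ x ^ 2 < m₂' x)
    (hm₃ : ∀ x ∈ Ico c 1, HasDerivAt m₃ (m₃' x) x ∧ q x + m₃ x ^ 2 < m₃' x)
    (h₁₂ : m₁ (-c) ≤ m₂ (-c)) (h₂₃ : m₂ c ≤ m₃ c) :
    {x | x ∈ Ioo (-1 : ℝ) 1 ∧ u x = 0}.Subsingleton := by
  suffices H : ∀ a ∈ Ioo (-1 : ℝ) 1, ∀ b ∈ Ioo (-1 : ℝ) 1, u a = 0 → u b = 0 → ¬ a < b by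
    rintro a ⟨ha, ha0⟩ b ⟨hb, hb0⟩
    exact le_antisymm (not_lt.1 (H b hb a ha hb0 ha0)) (not_lt.1 (H a ha b hb ha0 hb0))
  intro a ha b hb ha0 hb0 hab
  have mono := fun (m m' : ℝ → ℝ) (s t : ℝ) (hst : s < t) (hs : -1 < s) (ht : t < 1)
    (h : ∀ x ∈ Icc s t, HasDerivAt m (m' x) x ∧ q x + m x ^ 2 < m' x) =>
    riccati_strict_mono hq hu hne hst hs ht (fun x hx => (h x hx).1) (fun x hx => (h x hx).2)
  -- s and t are -c and c clamped to [a, b]. A clamped point that is not a breakpoint is a zero of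
  -- u, where the jump contributes nothing.
  obtain ⟨s, t, has, hst, htb, h1, h2, h3, h4, h5⟩ : ∃ s t, a ≤ s ∧ s ≤ t ∧ t ≤ b ∧
      (a < s → s ≤ -c) ∧ (s < t → -c ≤ s ∧ t ≤ c) ∧ (t < b → c ≤ t) ∧
      (s = a ∨ s = b ∨ s = -c) ∧ (t = a ∨ t = b ∨ t = c) := by
    refine ⟨max a (min b (-c)), max a (min b c), ?_⟩
    rcases le_total a (-c) with h1 | h1 <;> rcases le_total b (-c) with h2 | h2 <;>
      rcases le_total a c with h3 | h3 <;> rcases le_total b c with h4 | h4 <;>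
      simp only [max_def, min_def] <;> split_ifs <;> grind
  have j1 : m₁ s * u s ^ 2 ≤ m₂ s * u s ^ 2 := by
    rcases h4 with rfl | rfl | rfl
    · simp [ha0]
    · simp [hb0]
    · gcongr
  have j2 : m₂ t * u t ^ 2 ≤ m₃ t * u t ^ 2 := by
    rcases h5 with rfl | rfl | rfl
    · simp [ha0]
    · simp [hb0]
    · gcongr
  have i1 : a < s → u a * deriv u a + m₁ a * u a ^ 2 < u s * deriv u s + m₁ s * u s ^ 2 :=
    fun h => mono m₁ m₁' a s h ha.1 (by linarith [hb.2])
      fun x hx => hm₁ x ⟨ha.1.trans_le hx.1, hx.2.trans (h1 h)⟩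
  have i2 : s < t → u s * deriv u s + m₂ s * u s ^ 2 < u t * deriv u t + m₂ t * u t ^ 2 :=
    fun h => mono m₂ m₂' s t h (by linarith [ha.1]) (by linarith [hb.2])
      fun x hx => hm₂ x ⟨(h2 h).1.trans hx.1, hx.2.trans (h2 h).2⟩
  have i3 : t < b → u t * deriv u t + m₃ t * u t ^ 2 < u b * deriv u b + m₃ b * u b ^ 2 :=
    fun h => mono m₃ m₃' t b h (by linarith [ha.1]) hb.2
      fun x hx => hm₃ x ⟨(h3 h).trans hx.1, hx.2.trans_lt hb.2⟩
  simp only [ha0, hb0] at i1 i3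
  -- The quantity u u' + m u² vanishes at both zeros, yet increases strictly on each nondegenerate
  -- piece and never drops at a jump. Since a < b, some piece is nondegenerate.
  rcases has.eq_or_lt with e1 | e1
  · subst e1
    rcases hst.eq_or_lt with e2 | e2
    · subst e2
      have := i3 (by linarith)
      simp only [ha0] at this
      linarith
    · have k2 := i2 e2
      rcases htb.eq_or_lt with e3 | e3
      · subst e3
        simp only [ha0, hb0] at k2; linarith
      · have := i3 e3
        simp only [ha0] at k2; linarith
  · have k1 := i1 e1
    rcases hst.eq_or_lt with e2 | e2
    · subst e2
      rcases htb.eq_or_lt with e3 | e3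
      · subst e3
        simp only [hb0] at k1; linarith
      · have := i3 e3; linarith
    · have k2 := i2 e2
      rcases htb.eq_or_lt with e3 | e3
      · subst e3
        simp only [hb0] at k2; linarith
      · have := i3 e3; linarith

/-! ### The initial solution of a Nehari function -/

theorem IsNehari.initial_even {p u : ℝ → ℝ} (hp : IsNehari p) (hu : IsInitialSolution p u) :
    ∀ x ∈ Ioo (-1 : ℝ) 1, u (-x) = u x := by
  have hneg : ∀ x ∈ Ioo (-1 : ℝ) 1, -x ∈ Ioo (-1 : ℝ) 1 := fun x hx =>
    ⟨by linarith [hx.2], by linarith [hx.1]⟩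
  refine linear_ode_unique (u := fun x => u (-x)) (u' := fun x => -deriv u (-x))
    (v' := deriv u) hp.cont (fun x hx => ⟨?_, ?_⟩) hu.1 (c := 0) (by norm_num) (by simp)
    (by simp [hu.2.2])
  · have := (hu.1 _ (hneg x hx)).1.comp x (hasDerivAt_neg x)
    simpa [Function.comp_def] using this
  · have := ((hu.1 _ (hneg x hx)).2.comp x (hasDerivAt_neg x)).neg
    simp only [Function.comp_def, hp.even x hx] at this
    refine this.congr_deriv ?_
    ring

/-- By evenness a zero x comes with the zero -x, so disconjugacy forces x = 0, where u = 1. The sign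
then follows from the intermediate value theorem. -/
theorem IsNehari.initial_pos {p u : ℝ → ℝ} (hp : IsNehari p) (hu : IsInitialSolution p u) :
    ∀ x ∈ Ioo (-1 : ℝ) 1, 0 < u x := by
  have h0 : (0 : ℝ) ∈ Ioo (-1 : ℝ) 1 := by norm_num
  have hne : ∀ x ∈ Ioo (-1 : ℝ) 1, u x ≠ 0 := by
    intro x hx hx0
    have hx' : -x ∈ Ioo (-1 : ℝ) 1 := ⟨by linarith [hx.2], by linarith [hx.1]⟩
    have := hp.disconj u hu.1 ⟨0, h0, by simp [hu.2.1]⟩ ⟨hx, hx0⟩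
      ⟨hx', (hp.initial_even hu x hx).trans hx0⟩
    have hx00 : x = 0 := by linarith
    rw [hx00, hu.2.1] at hx0
    exact one_ne_zero hx0
  intro x hx
  by_contra hneg
  have hc : ContinuousOn u (Ioo (-1) 1) := fun x hx => (hu.1 x hx).1.continuousAt.continuousWithinAt
  obtain ⟨y, hy, hy0⟩ := isPreconnected_Ioo.intermediate_value hx h0 hc
    (show (0 : ℝ) ∈ Icc (u x) (u 0) from ⟨not_lt.1 hneg, by simp [hu.2.1]⟩)
  exact hne y hy hy0

/-- The logarithmic derivative `-u'/u`. -/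
noncomputable def riccati (u : ℝ → ℝ) (x : ℝ) : ℝ := -(deriv u x / u x)

theorem IsNehari.hasDerivAt_riccati {p u : ℝ → ℝ} (hp : IsNehari p) (hu : IsInitialSolution p u)
    {x : ℝ} (hx : x ∈ Ioo (-1 : ℝ) 1) :
    HasDerivAt (riccati u) (p x + riccati u x ^ 2) x := by
  have h := (hp.initial_pos hu x hx).ne'
  have := ((hu.1 x hx).2.div (hu.1 x hx).1 h).neg
  refine this.congr_deriv ?_
  rw [riccati]
  field_simp
  ring

theorem IsNehari.riccati_neg {p u : ℝ → ℝ} (hp : IsNehari p) (hu : IsInitialSolution p u)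
    {x : ℝ} (hx : x ∈ Ioo (-1 : ℝ) 1) : riccati u (-x) = -riccati u x := by
  have hx' : -x ∈ Ioo (-1 : ℝ) 1 := ⟨by linarith [hx.2], by linarith [hx.1]⟩
  have h1 : HasDerivAt (fun y => u (-y)) (-deriv u (-x)) x := by
    have := (hu.1 _ hx').1.comp x (hasDerivAt_neg x)
    simpa [Function.comp_def] using this
  have h2 : (fun y => u (-y)) =ᶠ[nhds x] u := by
    filter_upwards [isOpen_Ioo.mem_nhds hx] with y hy using hp.initial_even hu y hy
  have h3 := (h1.congr_of_eventuallyEq h2.symm).unique (hu.1 x hx).1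
  rw [riccati, riccati, hp.initial_even hu x hx, ← h3]
  ring

theorem IsInitialSolution.riccati_zero {p u : ℝ → ℝ} (hu : IsInitialSolution p u) :
    riccati u 0 = 0 := by simp [riccati, hu.2.2]

/-- The Riccati function in the hyperbolic normalisation. -/
theorem IsNehari.hasDerivAt_hyp {p u : ℝ → ℝ} (hp : IsNehari p) (hu : IsInitialSolution p u)
    {x : ℝ} (hx : x ∈ Ioo (-1 : ℝ) 1) :
    HasDerivAt (fun x => (1 - x ^ 2) * riccati u x - x)
      (((1 - x ^ 2) ^ 2 * p x - 1 + ((1 - x ^ 2) * riccati u x - x) ^ 2) / (1 - x ^ 2)) x := by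
  have h : 1 - x ^ 2 ≠ 0 := by nlinarith [hx.1, hx.2]
  have := ((((hasDerivAt_id x).pow 2).const_sub 1).mul (hp.hasDerivAt_riccati hu hx)).sub
    (hasDerivAt_id x)
  refine this.congr_deriv ?_
  simp
  field_simp
  ring

theorem IsNehari.anti_abs {p : ℝ → ℝ} (hp : IsNehari p) {x y : ℝ} (hx : 0 ≤ x) (hxy : x ≤ |y|)
    (hy : |y| < 1) : (1 - y ^ 2) ^ 2 * p y ≤ (1 - x ^ 2) ^ 2 * p x := by
  have h := hp.anti ⟨hx, hxy.trans_lt hy⟩ ⟨hx.trans hxy, hy⟩ hxy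
  have : p |y| = p y := by
    rcases abs_choice y with h | h <;> rw [h]
    exact hp.even y (abs_lt.1 hy)
  simpa [this] using h

/-- A constant `∓d` in the hyperbolic normalisation is a Riccati subsolution where
`(1-x²)² q < 1 - d²`. -/
theorem riccati_hyp_const {d x Q : ℝ} (hx : |x| < 1) (hQ : (1 - x ^ 2) ^ 2 * Q < 1 - d ^ 2) :
    HasDerivAt (fun x => (x - d) / (1 - x ^ 2))
      (((1 - x ^ 2) + 2 * x * (x - d)) / (1 - x ^ 2) ^ 2) x ∧
      Q + ((x - d) / (1 - x ^ 2)) ^ 2 < ((1 - x ^ 2) + 2 * x * (x - d)) / (1 - x ^ 2) ^ 2 := by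
  have h : 0 < 1 - x ^ 2 := by nlinarith [(abs_lt.1 hx).1, (abs_lt.1 hx).2]
  constructor
  · have := ((hasDerivAt_id x).sub_const d).div (((hasDerivAt_id x).pow 2).const_sub 1) h.ne'
    refine this.congr_deriv ?_
    simp
    ring
  · rw [div_pow, ← sub_pos]
    have : ((1 - x ^ 2) + 2 * x * (x - d)) / (1 - x ^ 2) ^ 2 -
        (Q + (x - d) ^ 2 / (1 - x ^ 2) ^ 2) =
        (1 - d ^ 2 - (1 - x ^ 2) ^ 2 * Q) / (1 - x ^ 2) ^ 2 := by
      field_simp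
      ring
    rw [this]
    have := sub_pos.2 hQ
    positivity

/-- If the hyperbolic Riccati function is negative somewhere, then `k p` is still a Nehari function
for some `k > 1`. -/
theorem IsNehari.exists_mul_of_neg {p u : ℝ → ℝ} (hp : IsNehari p) (hu : IsInitialSolution p u)
    {c : ℝ} (hc0 : 0 ≤ c) (hc1 : c < 1) (hP : (1 - c ^ 2) ^ 2 * p c < 1)
    (hneg : (1 - c ^ 2) * riccati u c - c < 0) :
    ∃ k : ℝ, 1 < k ∧ IsNehari (fun x => k * p x) := by
  have hcI : Icc (-c) c ⊆ Ioo (-1 : ℝ) 1 := fun t ht => ⟨by linarith [ht.1], by linarith [ht.2]⟩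
  have hcc : c ∈ Icc (-c) c := ⟨by linarith, le_rfl⟩
  have hcm : -c ∈ Icc (-c) c := ⟨le_rfl, by linarith⟩
  have hc2 : 0 < 1 - c ^ 2 := by nlinarith
  obtain ⟨Y, hY⟩ := isCompact_Icc.exists_bound_of_continuousOn (f := riccati u) (s := Icc (-c) c)
    fun x hx => (hp.hasDerivAt_riccati hu (hcI hx)).continuousAt.continuousWithinAt
  obtain ⟨M, hM⟩ := isCompact_Icc.exists_bound_of_continuousOn (hp.cont.mono hcI)
  have hY0 : 0 ≤ Y := (norm_nonneg _).trans (hY c hcc)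
  have hM0 : 0 < M := (hp.pos c (hcI hcc)).trans_le ((le_abs_self _).trans (hM c hcc))
  set η := (1 - c ^ 2) * riccati u c - c with hη
  -- On [-c, c] the subsolution is y + g with g = ε e^{A(x+1)}. It needs (k-1)p + 2yg + g² < Ag. The
  -- terms on the left are at most g, 2Yg and g, so 2Y + 3 leaves one g for strictness.
  set A := 2 * Y + 3 with hA
  set P := (1 - c ^ 2) ^ 2 * p c with hPdef
  have hP0 : 0 < P := mul_pos (by positivity) (hp.pos c (hcI hcc))
  -- the size of the perturbation
  obtain ⟨ε, hε, hε1, hε2⟩ : ∃ ε : ℝ, 0 < ε ∧ ε * Real.exp (A * 2) ≤ 1 ∧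
      (1 - c ^ 2) * (ε * Real.exp (A * 2)) ≤ -η / 2 := by
    have he := Real.exp_pos (A * 2)
    refine ⟨min 1 (-η / 2 / (1 - c ^ 2)) / Real.exp (A * 2), ?_, ?_, ?_⟩
    · have : 0 < -η := by linarith
      positivity
    · rw [div_mul_cancel₀ _ he.ne']; exact min_le_left _ _
    · rw [div_mul_cancel₀ _ he.ne', mul_comm, ← le_div_iff₀ hc2]; exact min_le_right _ _
  -- The gap -η at c is shared equally: half pays for g, half for the outer constant d. Likewise 1 -
  -- P is split between d² and the enlargement of p.
  obtain ⟨d, hd, hd1, hd2⟩ : ∃ d : ℝ, 0 < d ∧ d ≤ -η / 2 ∧ d ^ 2 < (1 - P) / 2 := by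
    have h1 : 0 < (1 - P) / 2 := by linarith
    have h2 : 0 < -η / 2 := by linarith
    refine ⟨min (-η / 2) (min 1 ((1 - P) / 4)), by positivity, min_le_left _ _, ?_⟩
    set d := min (-η / 2) (min 1 ((1 - P) / 4))
    have h3 : d ≤ 1 := (min_le_right _ _).trans (min_le_left _ _)
    have h4 : d ≤ (1 - P) / 4 := (min_le_right _ _).trans (min_le_right _ _)
    have h5 : 0 < d := by positivity
    nlinarith
  obtain ⟨k, hk, hk1, hk2⟩ : ∃ k : ℝ, 1 < k ∧ (k - 1) * M ≤ ε ∧ k * P ≤ 1 - (1 - P) / 2 := by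
    refine ⟨1 + min (ε / M) ((1 - P) / 2 / P), ?_, ?_, ?_⟩
    · have : 0 < 1 - P := by linarith
      have : 0 < min (ε / M) ((1 - P) / 2 / P) := by positivity
      linarith
    · rw [add_sub_cancel_left, ← le_div_iff₀ hM0]; exact min_le_left _ _
    · have : min (ε / M) ((1 - P) / 2 / P) * P ≤ (1 - P) / 2 := by
        rw [← le_div_iff₀ hP0]; exact min_le_right _ _
      linarith
  refine ⟨k, hk, ?_⟩
  have hk0 : 0 < k := by linarith
  have hout : ∀ x, c ≤ |x| → |x| < 1 → (1 - x ^ 2) ^ 2 * (k * p x) < 1 - d ^ 2 := by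
    intro x h1 h2
    have := mul_le_mul_of_nonneg_left (hp.anti_abs hc0 h1 h2) hk0.le
    linarith
  have hg : ∀ x ∈ Icc (-c) c, ε ≤ ε * Real.exp (A * (x + 1)) ∧
      ε * Real.exp (A * (x + 1)) ≤ ε * Real.exp (A * 2) := by
    intro x hx
    have hA0 : 0 ≤ A := by positivity
    have h1 := hx.1
    have h2 := hx.2
    refine ⟨le_mul_of_one_le_right hε.le (Real.one_le_exp (mul_nonneg hA0 (by linarith))), ?_⟩
    gcongr
    linarith
  refine ⟨fun x hx => mul_pos hk0 (hp.pos x hx), fun x hx => by rw [hp.even x hx],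
    hp.cont.const_smul k, fun x hx y hy hxy => ?_, fun f hf hne => ?_⟩
  · have := mul_le_mul_of_nonneg_left (hp.anti hx hy hxy) hk0.le
    simp only at this ⊢
    linarith
  · refine disconj_of_riccati (q := fun x => k * p x) (c := c)
      (m₁ := fun x => (x - -d) / (1 - x ^ 2))
      (m₁' := fun x => ((1 - x ^ 2) + 2 * x * (x - -d)) / (1 - x ^ 2) ^ 2)
      (m₂ := fun x => riccati u x + ε * Real.exp (A * (x + 1)))
      (m₂' := fun x => p x + riccati u x ^ 2 + ε * (Real.exp (A * (x + 1)) * A))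
      (m₃ := fun x => (x - d) / (1 - x ^ 2))
      (m₃' := fun x => ((1 - x ^ 2) + 2 * x * (x - d)) / (1 - x ^ 2) ^ 2) hc0
      (hp.cont.const_smul k) hf hne ?_ ?_ ?_ ?_ ?_
    · intro x hx
      have hx0 : |x| = -x := abs_of_nonpos (by linarith [hx.2])
      exact riccati_hyp_const (by rw [hx0]; linarith [hx.1])
        (by rw [neg_sq]; exact hout x (by rw [hx0]; linarith [hx.2]) (by rw [hx0]; linarith [hx.1]))
    · intro x hx
      constructor
      · refine (hp.hasDerivAt_riccati hu (hcI hx)).add (HasDerivAt.const_mul ε ?_)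
        have := ((hasDerivAt_id x).add_const (1 : ℝ)).const_mul A
        simpa using this.exp
      · obtain ⟨h1, h2⟩ := hg x hx
        have h3 := (abs_le.1 (hY x hx)).2
        have h4 := mul_le_mul_of_nonneg_left ((le_abs_self _).trans (hM x hx)) (sub_pos.2 hk).le
        rw [← mul_assoc]
        set g := ε * Real.exp (A * (x + 1))
        have h5 : 0 < g := by linarith
        have h6 : g * g ≤ g * 1 := mul_le_mul_of_nonneg_left (h2.trans hε1) h5.le
        have h7 := mul_le_mul_of_nonneg_left h3 h5.le
        rw [hA]
        linarith
    · intro x hx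
      have hx0 : |x| = x := abs_of_nonneg (by linarith [hx.1])
      exact riccati_hyp_const (by rw [hx0]; linarith [hx.2])
        (hout x (by rw [hx0]; linarith [hx.1]) (by rw [hx0]; linarith [hx.2]))
    · obtain ⟨h1, h2⟩ := hg (-c) hcm
      simp only [hp.riccati_neg hu (hcI hcc), neg_sq]
      rw [div_le_iff₀ hc2]
      have := mul_pos (hε.trans_le h1) hc2
      linarith
    -- Multiplied by 1 - c², the jump condition at c reads η + (1-c²)g(c) ≤ -d.
    · obtain ⟨h1, h2⟩ := hg c hcc
      rw [le_div_iff₀ hc2]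
      have := mul_le_mul_of_nonneg_left h2 hc2.le
      linarith

/-- The hyperbolic Riccati function of an extremal Nehari function is nonnegative on `[0,1)`. -/
theorem IsExtremalNehari.hyp_nonneg {p u : ℝ → ℝ} (hp : IsExtremalNehari p)
    (hu : IsInitialSolution p u) {x : ℝ} (hx : x ∈ Ico (0 : ℝ) 1) :
    0 ≤ (1 - x ^ 2) * riccati u x - x := by
  by_contra! hneg
  have hI : ∀ t ∈ Icc 0 x, t ∈ Ioo (-1 : ℝ) 1 := fun t ht =>
    ⟨by linarith [ht.1], ht.2.trans_lt hx.2⟩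
  -- If (1-x²)²p ≥ 1 at x, the same holds on all of [0, x], so η is nondecreasing there and cannot
  -- fall below η(0) = 0.
  have hP : (1 - x ^ 2) ^ 2 * p x < 1 := by
    by_contra! hP
    have hmono : MonotoneOn (fun x => (1 - x ^ 2) * riccati u x - x) (Icc 0 x) := by
      refine monotoneOn_of_deriv_nonneg (convex_Icc 0 x)
        (fun t ht => (hp.1.hasDerivAt_hyp hu (hI t ht)).continuousAt.continuousWithinAt)
        (fun t ht => (hp.1.hasDerivAt_hyp hu
          (hI t (interior_subset ht))).differentiableAt.differentiableWithinAt) fun t ht => ?_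
      replace ht := interior_subset ht
      rw [(hp.1.hasDerivAt_hyp hu (hI t ht)).deriv]
      have h1 := hp.1.anti (show t ∈ Ico (0 : ℝ) 1 from ⟨ht.1, (hI t ht).2⟩) hx ht.2
      have h2 : 0 < 1 - t ^ 2 := by nlinarith [(hI t ht).1, (hI t ht).2]
      simp only at h1
      refine div_nonneg (add_nonneg (by linarith) (sq_nonneg _)) h2.le
    have := hmono (left_mem_Icc.2 hx.1) (right_mem_Icc.2 hx.1) hx.1
    simp only [hu.riccati_zero] at this
    linarith
  obtain ⟨k, hk, hk'⟩ := hp.1.exists_mul_of_neg hu hx.1 hx.2 hP hneg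
  exact hp.2 k hk hk'

/-- The comparison `p ≤ y² + y / x` for `y = -u'/u` and an extremal Nehari function `p`. -/
theorem IsExtremalNehari.le_riccati {p u : ℝ → ℝ} (hp : IsExtremalNehari p)
    (hu : IsInitialSolution p u) {x : ℝ} (hx : x ∈ Ioo (0 : ℝ) 1) :
    p x ≤ riccati u x ^ 2 + riccati u x / x := by
  have hx' : x ∈ Ico (0 : ℝ) 1 := ⟨hx.1.le, hx.2⟩
  have hx2 : 0 < 1 - x ^ 2 := by nlinarith [hx.1, hx.2]
  have hη := hp.hyp_nonneg hu hx'
  set η := (1 - x ^ 2) * riccati u x - x with hηdef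
  have hy : riccati u x = (x + η) / (1 - x ^ 2) := by rw [hηdef]; field_simp; ring
  -- This is the claim p ≤ y² + y/x multiplied by (1-x²)², after substituting y = (x+η)/(1-x²).
  have key : (1 - x ^ 2) ^ 2 * p x - 1 ≤ η ^ 2 + η * (x + 1 / x) := by
    rcases le_total ((1 - x ^ 2) ^ 2 * p x) 1 with h | h
    · have := hx.1
      have : 0 ≤ η ^ 2 + η * (x + 1 / x) := by positivity
      linarith
    -- Monotonicity gives (1-t²)²p(t) - 1 ≥ q ≥ 0 for t ≤ x, hence η' ≥ q and η(x) ≥ qx. Then η(x +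
    -- 1/x) ≥ qx² + q ≥ q.
    · set q := (1 - x ^ 2) ^ 2 * p x - 1 with hq
      have hI : ∀ t ∈ Icc 0 x, t ∈ Ioo (-1 : ℝ) 1 := fun t ht =>
        ⟨by linarith [ht.1], ht.2.trans_lt hx.2⟩
      have hd : ∀ t ∈ Icc 0 x, HasDerivAt (fun t => (1 - t ^ 2) * riccati u t - t - q * t) _ t :=
        fun t ht => (hp.1.hasDerivAt_hyp hu (hI t ht)).sub ((hasDerivAt_id t).const_mul q)
      have hmono : MonotoneOn (fun t => (1 - t ^ 2) * riccati u t - t - q * t) (Icc 0 x) := by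
        refine monotoneOn_of_deriv_nonneg (convex_Icc 0 x)
          (fun t ht => (hd t ht).continuousAt.continuousWithinAt)
          (fun t ht => (hd t (interior_subset ht)).differentiableAt.differentiableWithinAt)
          fun t ht => ?_
        replace ht := interior_subset ht
        rw [(hd t ht).deriv, sub_nonneg, mul_one]
        have h1 := hp.1.anti (show t ∈ Ico (0 : ℝ) 1 from ⟨ht.1, (hI t ht).2⟩) hx' ht.2
        have h2 : 0 < 1 - t ^ 2 := by nlinarith [(hI t ht).1, (hI t ht).2]
        simp only at h1
        rw [le_div_iff₀ h2]
        have h3 : 0 ≤ q * t ^ 2 := mul_nonneg (by linarith) (sq_nonneg _)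
        have h4 := sq_nonneg ((1 - t ^ 2) * riccati u t - t)
        linarith
      have h1 := hmono (left_mem_Icc.2 hx.1.le) (right_mem_Icc.2 hx.1.le) hx.1.le
      simp only [hu.riccati_zero] at h1
      have h2 : q * x ≤ η := by linarith
      have h3 := mul_le_mul_of_nonneg_right h2 (show 0 ≤ x + 1 / x by have := hx.1; positivity)
      have h4 : q * x * (x + 1 / x) = q * x ^ 2 + q := by have := hx.1; field_simp
      have h5 : 0 ≤ q * x ^ 2 := mul_nonneg (by linarith) (sq_nonneg _)
      nlinarith [sq_nonneg η]
  have h1 : riccati u x ^ 2 + riccati u x / x =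
      (1 + η ^ 2 + η * (x + 1 / x)) / (1 - x ^ 2) ^ 2 := by
    have := hx.1
    rw [hy]; field_simp; ring
  rw [h1, le_div_iff₀ (by positivity)]
  linarith

/-! ### Partial derivatives in the plane -/

/-- The real linear functional with coefficients `a`, `b` in Cartesian coordinates. -/
noncomputable def covec (a b : ℝ) : ℂ →L[ℝ] ℝ := a • Complex.reCLM + b • Complex.imCLM

@[simp] theorem covec_apply (a b : ℝ) (z : ℂ) : covec a b z = a * z.re + b * z.im := rfl

theorem pd_eq_of_hasFDerivAt {f : ℂ → ℝ} {a b : ℝ} {z : ℂ} (h : HasFDerivAt f (covec a b) z) :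
    pd 0 f z = a ∧ pd 1 f z = b := by
  simp [pd, h.fderiv]

theorem pd_congr {f g : ℂ → ℝ} {U : Set ℂ} (hU : IsOpen U) (h : EqOn f g U) (i : Fin 2) :
    EqOn (pd i f) (pd i g) U := fun z hz => by
  have : f =ᶠ[nhds z] g := by filter_upwards [hU.mem_nhds hz] with w hw using h hw
  rw [pd, pd, this.fderiv_eq]

theorem contDiffOn_pd {f : ℂ → ℝ} {U : Set ℂ} {m n : WithTop ℕ∞} (hU : IsOpen U)
    (hf : ContDiffOn ℝ n f U) (hmn : m + 1 ≤ n) (i : Fin 2) : ContDiffOn ℝ m (pd i f) U :=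
  (hf.fderiv_of_isOpen hU hmn).clm_apply contDiffOn_const

/-- A function whose partial derivatives are `C¹` is `C²`. -/
theorem contDiffOn_two_of_partials {f : ℂ → ℝ} {U : Set ℂ} (hU : IsOpen U) {g h : ℂ → ℝ}
    {g₀ g₁ h₀ h₁ : ℂ → ℝ} (hf : ∀ z ∈ U, HasFDerivAt f (covec (g z) (h z)) z)
    (hg : ∀ z ∈ U, HasFDerivAt g (covec (g₀ z) (g₁ z)) z)
    (hh : ∀ z ∈ U, HasFDerivAt h (covec (h₀ z) (h₁ z)) z)
    (cg₀ : ContinuousOn g₀ U) (cg₁ : ContinuousOn g₁ U)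
    (ch₀ : ContinuousOn h₀ U) (ch₁ : ContinuousOn h₁ U) : ContDiffOn ℝ 2 f U := by
  have step : ∀ (n : ℕ) (f g h : ℂ → ℝ), (∀ z ∈ U, HasFDerivAt f (covec (g z) (h z)) z) →
      ContDiffOn ℝ n g U → ContDiffOn ℝ n h U → ContDiffOn ℝ (n + 1) f U := by
    intro n f g h hf hg hh
    refine (contDiffOn_succ_iff_fderiv_of_isOpen hU).2
      ⟨fun z hz => (hf z hz).differentiableAt.differentiableWithinAt, by simp, ?_⟩
    refine ContDiffOn.congr (f := fun z => covec (g z) (h z)) ?_ fun z hz => (hf z hz).fderiv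
    exact (hg.smul contDiffOn_const).add (hh.smul contDiffOn_const)
  have h1 := step 0 g g₀ g₁ hg (by simpa using cg₀) (by simpa using cg₁)
  have h2 := step 0 h h₀ h₁ hh (by simpa using ch₀) (by simpa using ch₁)
  have := step 1 f g h hf (by simpa using h1) (by simpa using h2)
  simpa [one_add_one_eq_two] using this

/-! ### Radial functions -/

theorem hasFDerivAt_complex_norm {z : ℂ} (hz : z ≠ 0) :
    HasFDerivAt (fun z : ℂ => ‖z‖) (covec (z.re / ‖z‖) (z.im / ‖z‖)) z := by
  have h1 : HasFDerivAt (fun z : ℂ => z.re ^ 2 + z.im ^ 2) (covec (2 * z.re) (2 * z.im)) z := by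
    have := (Complex.reCLM.hasFDerivAt (x := z)).pow 2 |>.add
      ((Complex.imCLM.hasFDerivAt (x := z)).pow 2)
    refine this.congr_fderiv ?_
    ext w
    simp
  have hn : ∀ z : ℂ, √(z.re ^ 2 + z.im ^ 2) = ‖z‖ := fun z => by
    rw [Complex.norm_eq_sqrt_sq_add_sq]
  have hpos : z.re ^ 2 + z.im ^ 2 ≠ 0 := by
    intro h
    have := hn z
    rw [h, Real.sqrt_zero] at this
    exact hz (norm_eq_zero.1 this.symm)
  have h2 := h1.sqrt hpos
  simp only [hn] at h2
  refine h2.congr_fderiv ?_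
  have := norm_pos_iff.2 hz
  ext w
  simp
  field_simp

theorem covec_smul (c a b : ℝ) : c • covec a b = covec (c * a) (c * b) := by
  ext w; simp; ring

/-- `R'(r)/r`, extended by `R''(0)` at the origin. -/
noncomputable def radialQuot (R' R'' : ℝ → ℝ) (r : ℝ) : ℝ := if r = 0 then R'' 0 else R' r / r

section Radial

variable {R R' R'' : ℝ → ℝ}

theorem continuousAt_radialQuot (h0 : R' 0 = 0)
    (hR' : HasDerivAt R' (R'' 0) 0) : ContinuousAt (radialQuot R' R'') 0 := by
  rw [← continuousWithinAt_compl_self, ContinuousWithinAt]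
  have := hasDerivAt_iff_tendsto_slope.1 hR'
  have e : radialQuot R' R'' 0 = R'' 0 := by simp [radialQuot]
  rw [e]
  refine this.congr' ?_
  filter_upwards [self_mem_nhdsWithin] with r hr
  have hr : r ≠ 0 := hr
  simp [slope_def_field, radialQuot, hr, h0]

theorem hasFDerivAt_radial (h0 : R' 0 = 0) {z : ℂ} (hR : HasDerivAt R (R' ‖z‖) ‖z‖) :
    HasFDerivAt (fun z : ℂ => R ‖z‖)
      (covec (radialQuot R' R'' ‖z‖ * z.re) (radialQuot R' R'' ‖z‖ * z.im)) z := by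
  by_cases hz : z = 0
  · subst hz
    rw [norm_zero, h0] at hR
    have h1 : (fun h => R h - R 0) =o[nhds 0] fun h => h := by
      simpa using hasDerivAt_iff_isLittleO_nhds_zero.1 hR
    have h2 := h1.comp_tendsto (tendsto_norm_zero (E := ℂ))
    rw [hasFDerivAt_iff_isLittleO_nhds_zero]
    refine (h2.congr_left fun h => ?_).norm_right.congr_right (by simp) |>.of_norm_right
    simp
  · have hr : ‖z‖ ≠ 0 := norm_ne_zero_iff.2 hz
    refine (hR.comp_hasFDerivAt z (hasFDerivAt_complex_norm hz)).congr_fderiv ?_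
    rw [covec_smul]
    congr 1 <;> · simp only [radialQuot, if_neg hr]; ring

theorem hasFDerivAt_radialQuot {z : ℂ} (hz : z ≠ 0) (hR' : HasDerivAt R' (R'' ‖z‖) ‖z‖) :
    HasFDerivAt (fun z : ℂ => radialQuot R' R'' ‖z‖)
      (covec ((R'' ‖z‖ - radialQuot R' R'' ‖z‖) / ‖z‖ ^ 2 * z.re)
        ((R'' ‖z‖ - radialQuot R' R'' ‖z‖) / ‖z‖ ^ 2 * z.im)) z := by
  have hr : ‖z‖ ≠ 0 := norm_ne_zero_iff.2 hz
  have h1 : HasDerivAt (radialQuot R' R'') ((R'' ‖z‖ - R' ‖z‖ / ‖z‖) / ‖z‖) ‖z‖ := by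
    have := hR'.div (hasDerivAt_id ‖z‖) hr
    refine (this.congr_deriv ?_).congr_of_eventuallyEq ?_
    · simp; field_simp
    · filter_upwards [isOpen_ne.mem_nhds hr] with r hr
      simp [radialQuot, show r ≠ 0 from hr]
  refine (h1.comp_hasFDerivAt z (hasFDerivAt_complex_norm hz)).congr_fderiv ?_
  rw [covec_smul]
  congr 1 <;> · simp only [radialQuot, if_neg hr]; field_simp

/-- Derivative of `κ(|z|) ℓ(z)` for a linear functional `ℓ`, where `κ = R'/r`. -/
theorem hasFDerivAt_radialQuot_mul (h0 : R' 0 = 0) {z : ℂ} (hR' : HasDerivAt R' (R'' ‖z‖) ‖z‖)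
    (a b : ℝ) :
    HasFDerivAt (fun z : ℂ => radialQuot R' R'' ‖z‖ * covec a b z)
      (covec ((R'' ‖z‖ - radialQuot R' R'' ‖z‖) / ‖z‖ ^ 2 * z.re * covec a b z +
          radialQuot R' R'' ‖z‖ * a)
        ((R'' ‖z‖ - radialQuot R' R'' ‖z‖) / ‖z‖ ^ 2 * z.im * covec a b z +
          radialQuot R' R'' ‖z‖ * b)) z := by
  by_cases hz : z = 0
  · subst hz
    rw [norm_zero] at hR'
    have hc : ContinuousAt (fun z : ℂ => radialQuot R' R'' ‖z‖) 0 := by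
      refine ContinuousAt.comp (g := radialQuot R' R'') (f := fun z : ℂ => ‖z‖) ?_ continuous_norm.continuousAt
      rw [norm_zero]
      exact continuousAt_radialQuot h0 hR'
    -- The quotient κ = R'/r need not be differentiable at 0, but κℓ - κ(0)ℓ = o(1)·O(|z|), so
    -- continuity of κ suffices.
    have h1 : (fun z : ℂ => radialQuot R' R'' ‖z‖ - radialQuot R' R'' 0) =o[nhds 0]
        fun _ => (1 : ℝ) := by
      rw [Asymptotics.isLittleO_one_iff]
      have := hc.tendsto.sub_const (radialQuot R' R'' 0)
      simpa using this
    have h2 : (fun z : ℂ => covec a b z) =O[nhds 0] fun z => z :=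
      ContinuousLinearMap.isBigO_id _ _
    have h3 := h1.mul_isBigO h2.norm_right
    rw [hasFDerivAt_iff_isLittleO_nhds_zero]
    refine (h3.congr_left fun w => ?_).congr_right (by simp) |>.of_norm_right
    simp
    ring
  · refine ((hasFDerivAt_radialQuot hz hR').mul (covec a b).hasFDerivAt).congr_fderiv ?_
    ext w
    simp
    ring

/-- The coefficient (R'' - κ)/r² may be unbounded at the origin. The factor l = O(r²) absorbs the
denominator, and R'' - κ tends to 0. -/
theorem continuousAt_radial_second (h0 : R' 0 = 0) {z : ℂ}
    (hR' : HasDerivAt R' (R'' ‖z‖) ‖z‖) (hR'' : ContinuousAt R'' ‖z‖) {l : ℂ → ℝ}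
    (hl : Continuous l) (hlb : ∀ z, |l z| ≤ ‖z‖ ^ 2) (a : ℝ) :
    ContinuousAt (fun z : ℂ => (R'' ‖z‖ - radialQuot R' R'' ‖z‖) / ‖z‖ ^ 2 * l z +
      radialQuot R' R'' ‖z‖ * a) z := by
  have cn : ContinuousAt (fun z : ℂ => ‖z‖) z := continuous_norm.continuousAt
  have cR : ContinuousAt (fun z : ℂ => R'' ‖z‖) z :=
    ContinuousAt.comp (g := R'') (f := fun z : ℂ => ‖z‖) hR'' cn
  have cκ : ContinuousAt (fun z : ℂ => radialQuot R' R'' ‖z‖) z := by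
    by_cases hz : z = 0
    · subst hz
      rw [norm_zero] at hR'
      refine ContinuousAt.comp (g := radialQuot R' R'') (f := fun z : ℂ => ‖z‖) ?_ cn
      rw [norm_zero]
      exact continuousAt_radialQuot h0 hR'
    · exact (hasFDerivAt_radialQuot hz hR').continuousAt
  refine ContinuousAt.add ?_ (cκ.mul continuousAt_const)
  by_cases hz : z = 0
  · subst hz
    have h1 : ContinuousAt (fun z : ℂ => R'' ‖z‖ - radialQuot R' R'' ‖z‖) 0 := cR.sub cκ
    have e : R'' 0 - radialQuot R' R'' 0 = 0 := by simp [radialQuot]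
    rw [ContinuousAt] at h1 ⊢
    simp only [norm_zero, e, zero_div, zero_mul] at h1 ⊢
    refine squeeze_zero_norm (fun w => ?_) (tendsto_zero_iff_norm_tendsto_zero.1 h1)
    rw [norm_mul, norm_div, norm_pow, norm_norm, Real.norm_eq_abs (l w), div_mul_eq_mul_div]
    by_cases hw : w = 0
    · simp [hw]
    · rw [div_le_iff₀ (by positivity)]
      gcongr
      exact hlb w
  · have hr : ‖z‖ ^ 2 ≠ 0 := pow_ne_zero 2 (norm_ne_zero_iff.2 hz)
    exact ((cR.sub cκ).div (cn.pow 2) hr).mul hl.continuousAt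

/-- A radial function with even `C²` profile is `C²`, with explicit partial derivatives. -/
theorem radial_partials (h0 : R' 0 = 0)
    (hR : ∀ r ∈ Ico (0 : ℝ) 1, HasDerivAt R (R' r) r)
    (hR' : ∀ r ∈ Ico (0 : ℝ) 1, HasDerivAt R' (R'' r) r)
    (hR'' : ∀ r ∈ Ico (0 : ℝ) 1, ContinuousAt R'' r) :
    ContDiffOn ℝ 2 (fun z : ℂ => R ‖z‖) (ball 0 1) ∧ ∀ z ∈ ball (0 : ℂ) 1,
      pd 0 (fun z : ℂ => R ‖z‖) z = radialQuot R' R'' ‖z‖ * z.re ∧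
      pd 1 (fun z : ℂ => R ‖z‖) z = radialQuot R' R'' ‖z‖ * z.im ∧
      pd 0 (pd 0 (fun z : ℂ => R ‖z‖)) z =
        (R'' ‖z‖ - radialQuot R' R'' ‖z‖) / ‖z‖ ^ 2 * z.re ^ 2 + radialQuot R' R'' ‖z‖ ∧
      pd 0 (pd 1 (fun z : ℂ => R ‖z‖)) z =
        (R'' ‖z‖ - radialQuot R' R'' ‖z‖) / ‖z‖ ^ 2 * (z.re * z.im) ∧
      pd 1 (pd 1 (fun z : ℂ => R ‖z‖)) z =
        (R'' ‖z‖ - radialQuot R' R'' ‖z‖) / ‖z‖ ^ 2 * z.im ^ 2 + radialQuot R' R'' ‖z‖ := by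
  have hmem : ∀ z ∈ ball (0 : ℂ) 1, ‖z‖ ∈ Ico (0 : ℝ) 1 := fun z hz =>
    ⟨norm_nonneg z, by simpa using hz⟩
  have hF := fun z hz => hasFDerivAt_radial (R'' := R'') h0 (hR _ (hmem z hz))
  have hx := fun z hz => hasFDerivAt_radialQuot_mul h0 (hR' _ (hmem z hz)) 1 0
  have hy := fun z hz => hasFDerivAt_radialQuot_mul h0 (hR' _ (hmem z hz)) 0 1
  simp only [covec_apply, one_mul, zero_mul, zero_add, add_zero, mul_zero, mul_one] at hx hy
  have e0 : EqOn (pd 0 fun z : ℂ => R ‖z‖) (fun z => radialQuot R' R'' ‖z‖ * z.re) (ball 0 1) :=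
    fun z hz => (pd_eq_of_hasFDerivAt (hF z hz)).1
  have e1 : EqOn (pd 1 fun z : ℂ => R ‖z‖) (fun z => radialQuot R' R'' ‖z‖ * z.im) (ball 0 1) :=
    fun z hz => (pd_eq_of_hasFDerivAt (hF z hz)).2
  have b1 : ∀ z : ℂ, |z.re * z.re| ≤ ‖z‖ ^ 2 := fun z => by
    rw [abs_mul, sq]; gcongr <;> exact Complex.abs_re_le_norm z
  have b2 : ∀ z : ℂ, |z.im * z.im| ≤ ‖z‖ ^ 2 := fun z => by
    rw [abs_mul, sq]; gcongr <;> exact Complex.abs_im_le_norm z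
  have b3 : ∀ z : ℂ, |z.re * z.im| ≤ ‖z‖ ^ 2 := fun z => by
    rw [abs_mul, sq]; gcongr; exacts [Complex.abs_re_le_norm z, Complex.abs_im_le_norm z]
  have hcont : ∀ (l : ℂ → ℝ), Continuous l → (∀ z, |l z| ≤ ‖z‖ ^ 2) → ∀ a, ContinuousOn
      (fun z : ℂ => (R'' ‖z‖ - radialQuot R' R'' ‖z‖) / ‖z‖ ^ 2 * l z +
        radialQuot R' R'' ‖z‖ * a) (ball 0 1) := fun l hl hlb a z hz =>
    (continuousAt_radial_second h0 (hR' _ (hmem z hz)) (hR'' _ (hmem z hz)) hl hlb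
      a).continuousWithinAt
  refine ⟨contDiffOn_two_of_partials isOpen_ball hF hx hy ?_ ?_ ?_ ?_, fun z hz =>
    ⟨e0 hz, e1 hz, ?_, ?_, ?_⟩⟩
  · exact (hcont (fun z => z.re * z.re) (by fun_prop) b1 1).congr fun z _ => by ring
  · exact (hcont (fun z => z.re * z.im) (by fun_prop) b3 0).congr fun z _ => by ring
  · exact (hcont (fun z => z.re * z.im) (by fun_prop) b3 0).congr fun z _ => by ring
  · exact (hcont (fun z => z.im * z.im) (by fun_prop) b2 1).congr fun z _ => by ring
  · rw [pd_congr isOpen_ball e0 0 hz, (pd_eq_of_hasFDerivAt (hx z hz)).1]; ring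
  · rw [pd_congr isOpen_ball e1 0 hz, (pd_eq_of_hasFDerivAt (hy z hz)).1]; ring
  · rw [pd_congr isOpen_ball e1 1 hz, (pd_eq_of_hasFDerivAt (hy z hz)).2]; ring

end Radial

/-! ### Second derivatives -/

section SecondDerivatives

variable {f : ℂ → ℝ} {U : Set ℂ}

theorem pd_pd_eq (hU : IsOpen U) (hf : ContDiffOn ℝ 2 f U) {z : ℂ} (hz : z ∈ U) (i j : Fin 2) :
    pd i (pd j f) z =
      fderiv ℝ (fderiv ℝ f) z ((![1, Complex.I] : Fin 2 → ℂ) i)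
        ((![1, Complex.I] : Fin 2 → ℂ) j) := by
  have h : DifferentiableAt ℝ (fderiv ℝ f) z :=
    ((hf.fderiv_of_isOpen hU (m := 1) (by norm_num)).contDiffAt (hU.mem_nhds hz)).differentiableAt
      (by norm_num)
  change fderiv ℝ (fun w => fderiv ℝ f w ((![1, Complex.I] : Fin 2 → ℂ) j)) z _ = _
  rw [fderiv_clm_apply h (differentiableAt_const _)]
  simp

theorem pd_comm (hU : IsOpen U) (hf : ContDiffOn ℝ 2 f U) {z : ℂ} (hz : z ∈ U) (i j : Fin 2) :
    pd i (pd j f) z = pd j (pd i f) z := by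
  rw [pd_pd_eq hU hf hz, pd_pd_eq hU hf hz]
  exact (hf.contDiffAt (hU.mem_nhds hz)).isSymmSndFDerivAt (by simp) _ _

theorem laplacian_eq_pd (hU : IsOpen U) (hf : ContDiffOn ℝ 2 f U) {z : ℂ} (hz : z ∈ U) :
    Laplacian.laplacian f z = pd 0 (pd 0 f) z + pd 1 (pd 1 f) z := by
  rw [InnerProductSpace.laplacian_eq_iteratedFDeriv_complexPlane, pd_pd_eq hU hf hz,
    pd_pd_eq hU hf hz]
  simp [iteratedFDeriv_two_apply]

theorem pd_differentiableAt (hU : IsOpen U) (hf : ContDiffOn ℝ 2 f U) {z : ℂ}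
    (hz : z ∈ U) (i : Fin 2) : DifferentiableAt ℝ (pd i f) z :=
  ((contDiffOn_pd hU hf (m := 1) (by norm_num) i).contDiffAt (hU.mem_nhds hz)).differentiableAt
    (by norm_num)

/-! ### The operator `∂/∂z` -/

theorem dz_ofReal {z : ℂ} (hf : DifferentiableAt ℝ f z) :
    dz (fun ζ => (f ζ : ℂ)) z = (1 / 2) * ((pd 0 f z : ℂ) - Complex.I * (pd 1 f z : ℂ)) := by
  have h := Complex.ofRealCLM.hasFDerivAt.comp z hf.hasFDerivAt
  have h' : fderiv ℝ (fun ζ => (f ζ : ℂ)) z = Complex.ofRealCLM.comp (fderiv ℝ f z) := h.fderiv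
  simp [dz, h', pd]

theorem dz_dz_ofReal (hU : IsOpen U) (hf : ContDiffOn ℝ 2 f U) {z : ℂ} (hz : z ∈ U) :
    dz (dz fun ζ => (f ζ : ℂ)) z = (1 / 4) * ((pd 0 (pd 0 f) z : ℂ) - (pd 1 (pd 1 f) z : ℂ) -
      2 * Complex.I * (pd 0 (pd 1 f) z : ℂ)) := by
  have hd : ∀ w ∈ U, DifferentiableAt ℝ f w := fun w hw =>
    (hf.contDiffAt (hU.mem_nhds hw)).differentiableAt (by norm_num)
  have e : (dz fun ζ => (f ζ : ℂ)) =ᶠ[nhds z]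
      fun w => (1 / 2) * ((pd 0 f w : ℂ) - Complex.I * (pd 1 f w : ℂ)) := by
    filter_upwards [hU.mem_nhds hz] with w hw using dz_ofReal (hd w hw)
  have h0 := Complex.ofRealCLM.hasFDerivAt.comp z
    (pd_differentiableAt hU hf hz 0).hasFDerivAt
  have h1 := Complex.ofRealCLM.hasFDerivAt.comp z
    (pd_differentiableAt hU hf hz 1).hasFDerivAt
  have h := ((h0.sub (h1.const_mul Complex.I)).const_mul (1 / 2 : ℂ))
  have h' : fderiv ℝ (fun w => (1 / 2) * ((pd 0 f w : ℂ) - Complex.I * (pd 1 f w : ℂ))) z = _ :=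
    h.fderiv
  rw [dz, e.fderiv_eq, h']
  have c := pd_comm hU hf hz 1 0
  have p00 : fderiv ℝ (pd 0 f) z 1 = pd 0 (pd 0 f) z := rfl
  have p10 : fderiv ℝ (pd 0 f) z Complex.I = pd 1 (pd 0 f) z := rfl
  have p01 : fderiv ℝ (pd 1 f) z 1 = pd 0 (pd 1 f) z := rfl
  have p11 : fderiv ℝ (pd 1 f) z Complex.I = pd 1 (pd 1 f) z := rfl
  simp [p00, p01, p10, p11, c]
  linear_combination (1 / 4 : ℂ) * (pd 1 (pd 1 f) z : ℂ) * Complex.I_sq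

end SecondDerivatives

/-- The Schwarzian expression `2 (f_zz - f_z²)` in Cartesian partial derivatives. -/
noncomputable def schwarzPd (f : ℂ → ℝ) (z : ℂ) : ℂ :=
  (1 / 2) * (((pd 0 (pd 0 f) z - pd 1 (pd 1 f) z - pd 0 f z ^ 2 + pd 1 f z ^ 2 : ℝ) : ℂ) -
    ((2 * (pd 0 (pd 1 f) z - pd 0 f z * pd 1 f z) : ℝ) : ℂ) * Complex.I)

theorem schwarzian_eq {n : ℕ} {φ : ℂ → EuclideanSpace ℂ (Fin n)} {U : Set ℂ} (hU : IsOpen U)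
    (hf : ContDiffOn ℝ 2 (sigma φ) U) {z : ℂ} (hz : z ∈ U) :
    schwarzian φ z = schwarzPd (sigma φ) z := by
  rw [schwarzian, dz_dz_ofReal hU hf hz,
    dz_ofReal ((hf.contDiffAt (hU.mem_nhds hz)).differentiableAt (by norm_num)), schwarzPd]
  push_cast
  linear_combination (-1 / 2 : ℂ) * (pd 1 (sigma φ) z : ℂ) ^ 2 * Complex.I_sq

/-! ### Hessians for conformal metrics -/

section Hessian

variable {ρ τ f : ℂ → ℝ} {U : Set ℂ}

theorem pd_exp {z : ℂ} (hτ : DifferentiableAt ℝ τ z) (i : Fin 2) :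
    pd i (fun w => Real.exp (τ w)) z = Real.exp (τ z) * pd i τ z := by
  rw [pd, hτ.hasFDerivAt.exp.fderiv]
  simp [pd]

theorem pd_pd_exp (hU : IsOpen U) (hτ : ContDiffOn ℝ 2 τ U) {z : ℂ} (hz : z ∈ U) (i j : Fin 2) :
    pd i (pd j fun w => Real.exp (τ w)) z =
      Real.exp (τ z) * (pd i (pd j τ) z + pd i τ z * pd j τ z) := by
  have hd : ∀ w ∈ U, DifferentiableAt ℝ τ w := fun w hw =>
    (hτ.contDiffAt (hU.mem_nhds hw)).differentiableAt (by norm_num)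
  have h : HasFDerivAt (fun w => Real.exp (τ w) * pd j τ w) _ z := (hd z hz).hasFDerivAt.exp.mul
    (pd_differentiableAt hU hτ hz j).hasFDerivAt
  rw [pd_congr hU (fun w hw => pd_exp (hd w hw) j) i hz, pd, h.fderiv]
  simp [pd]
  ring

theorem christoffel_conformal {g : ℂ → Matrix (Fin 2) (Fin 2) ℝ} (hU : IsOpen U)
    (hg : ∀ w ∈ U, g w = Real.exp (2 * ρ w) • (1 : Matrix (Fin 2) (Fin 2) ℝ)) {z : ℂ} (hz : z ∈ U)
    (hρ : DifferentiableAt ℝ ρ z) (k i j : Fin 2) :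
    christoffel g k i j z = (if k = j then pd i ρ z else 0) + (if k = i then pd j ρ z else 0) -
      (if i = j then pd k ρ z else 0) := by
  have hpd : ∀ l i j : Fin 2, pd l (fun ζ => g ζ i j) z =
      if i = j then 2 * Real.exp (2 * ρ z) * pd l ρ z else 0 := by
    intro l i j
    have e : EqOn (fun ζ => g ζ i j) (fun ζ => if i = j then Real.exp (2 * ρ ζ) else 0) U := by
      intro w hw
      simp [hg w hw, Matrix.one_apply]
    rw [pd_congr hU e l hz]
    split_ifs
    · rw [pd_exp (hρ.const_mul 2), pd, (hρ.hasFDerivAt.const_mul 2).fderiv]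
      simp [pd]
      ring
    · simp [pd]
  have hinv : (g z)⁻¹ = Real.exp (-(2 * ρ z)) • (1 : Matrix (Fin 2) (Fin 2) ℝ) := by
    apply Matrix.inv_eq_right_inv
    rw [hg z hz, Matrix.smul_mul, Matrix.mul_smul, smul_smul, ← Real.exp_add]
    simp
  have he : Real.exp (-(2 * ρ z)) * Real.exp (2 * ρ z) = 1 := by rw [← Real.exp_add]; simp
  rw [christoffel]
  simp only [hpd, hinv, Matrix.smul_apply, Matrix.one_apply, smul_eq_mul, mul_ite, mul_one, mul_zero,
    ite_mul, zero_mul, Finset.sum_ite_eq, Finset.mem_univ, if_true]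
  have h1 : ∀ c : ℝ, Real.exp (-(2 * ρ z)) * (2 * Real.exp (2 * ρ z) * c) = 2 * c := fun c => by
    linear_combination 2 * c * he
  rw [mul_sub, mul_add]
  simp only [mul_ite, mul_zero, h1]
  fin_cases k <;> fin_cases i <;> fin_cases j <;> simp

theorem hess_conformal {g : ℂ → Matrix (Fin 2) (Fin 2) ℝ} (hU : IsOpen U)
    (hg : ∀ w ∈ U, g w = Real.exp (2 * ρ w) • (1 : Matrix (Fin 2) (Fin 2) ℝ)) {z : ℂ} (hz : z ∈ U)
    (hρ : DifferentiableAt ℝ ρ z) (i j : Fin 2) :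
    hess g f z i j = pd i (pd j f) z - pd i ρ z * pd j f z - pd j ρ z * pd i f z +
      if i = j then pd 0 ρ z * pd 0 f z + pd 1 ρ z * pd 1 f z else 0 := by
  simp only [hess, Matrix.of_apply, christoffel_conformal hU hg hz hρ, Fin.sum_univ_two]
  fin_cases i <;> fin_cases j <;> simp <;> ring

theorem hess_congr {g : ℂ → Matrix (Fin 2) (Fin 2) ℝ} {f' : ℂ → ℝ} (hU : IsOpen U)
    (h : EqOn f f' U) {z : ℂ} (hz : z ∈ U) : hess g f z = hess g f' z := by
  ext i j
  simp only [hess, Matrix.of_apply, pd_congr hU h _ hz, pd_congr hU (pd_congr hU h _) _ hz]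

/-- A symmetric real `2 × 2` matrix is at least `α` if its trace exceeds `2 α` by at least the
modulus of its trace-free part. -/
theorem smul_one_le_of_norm_le {M : Matrix (Fin 2) (Fin 2) ℝ} {α : ℝ} (hs : M 1 0 = M 0 1)
    (h : ‖((M 0 0 - M 1 1 : ℝ) : ℂ) - ((2 * M 0 1 : ℝ) : ℂ) * Complex.I‖ ≤
      M 0 0 + M 1 1 - 2 * α) : α • (1 : Matrix (Fin 2) (Fin 2) ℝ) ≤ M := by
  rw [Matrix.le_iff]
  refine Matrix.PosSemidef.of_dotProduct_mulVec_nonneg ?_ fun v => ?_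
  · ext i j
    fin_cases i <;> fin_cases j <;> simp [hs]
  · set C : ℂ := ((M 0 0 - M 1 1 : ℝ) : ℂ) - ((2 * M 0 1 : ℝ) : ℂ) * Complex.I
    -- With ζ = v₀ + iv₁ the quadratic form satisfies 2 vᵀMv = (tr M)|ζ|² + Re(Cζ²), and Re(Cζ²) ≥
    -- -|C||ζ|².
    set ζ : ℂ := ⟨v 0, v 1⟩
    have h1 : -(‖C‖ * ‖ζ‖ ^ 2) ≤ (C * ζ ^ 2).re := by
      have := (abs_le.1 (Complex.abs_re_le_norm (C * ζ ^ 2))).1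
      rwa [norm_mul, norm_pow] at this
    have h2 : (C * ζ ^ 2).re =
        (M 0 0 - M 1 1) * (v 0 ^ 2 - v 1 ^ 2) + 4 * M 0 1 * (v 0 * v 1) := by
      simp [C, ζ, sq]
      ring
    have h3 : ‖ζ‖ ^ 2 = v 0 ^ 2 + v 1 ^ 2 := by
      rw [Complex.sq_norm, Complex.normSq_apply]; simp [ζ]; ring
    have h4 := mul_le_mul_of_nonneg_right h (sq_nonneg ‖ζ‖)
    rw [h2] at h1
    rw [h3] at h1 h4
    simp [Matrix.mulVec, dotProduct, Fin.sum_univ_two, hs]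
    nlinarith

/-- Lower bound for the Hessian of `exp ((ρ-σ)/2)` relative to the metric `e^{2ρ} |dz|²`, in terms
of Schwarzians and Laplacians. -/
theorem le_hess_exp {σ : ℂ → ℝ} {g : ℂ → Matrix (Fin 2) (Fin 2) ℝ} (hU : IsOpen U)
    (hg : ∀ w ∈ U, g w = Real.exp (2 * ρ w) • (1 : Matrix (Fin 2) (Fin 2) ℝ))
    (hρ : ContDiffOn ℝ 2 ρ U) (hσ : ContDiffOn ℝ 2 σ U) {z : ℂ} (hz : z ∈ U) {β : ℝ}
    (h : ‖schwarzPd ρ z - schwarzPd σ z‖ + 2 * β ≤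
      (pd 0 (pd 0 ρ) z + pd 1 (pd 1 ρ) z) / 2 - (pd 0 (pd 0 σ) z + pd 1 (pd 1 σ) z) / 2) :
    (Real.exp ((ρ z - σ z) / 2) * β) • (1 : Matrix (Fin 2) (Fin 2) ℝ) ≤
      hess g (fun w => Real.exp ((ρ w - σ w) / 2)) z := by
  have hd : ∀ {f : ℂ → ℝ}, ContDiffOn ℝ 2 f U → ∀ w ∈ U, DifferentiableAt ℝ f w :=
    fun hf w hw => (hf.contDiffAt (hU.mem_nhds hw)).differentiableAt (by norm_num)
  set τ : ℂ → ℝ := fun w => (ρ w - σ w) / 2 with hτdef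
  have hτ : ContDiffOn ℝ 2 τ U := (hρ.sub hσ).div_const 2
  have lin : ∀ {f₁ f₂ : ℂ → ℝ} {w : ℂ}, DifferentiableAt ℝ f₁ w → DifferentiableAt ℝ f₂ w →
      ∀ i, pd i (fun w => (f₁ w - f₂ w) / 2) w = (pd i f₁ w - pd i f₂ w) / 2 := by
    intro f₁ f₂ w h₁ h₂ i
    have h : HasFDerivAt (fun w => (f₁ w - f₂ w) * 2⁻¹) _ w :=
      (h₁.hasFDerivAt.sub h₂.hasFDerivAt).mul_const 2⁻¹
    simp only [div_eq_mul_inv]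
    rw [pd, h.fderiv]
    simp [pd]
    ring
  have t1 : ∀ i, EqOn (pd i τ) (fun w => (pd i ρ w - pd i σ w) / 2) U := fun i w hw =>
    lin (hd hρ w hw) (hd hσ w hw) i
  have t2 : ∀ i j, pd i (pd j τ) z = (pd i (pd j ρ) z - pd i (pd j σ) z) / 2 := fun i j => by
    rw [pd_congr hU (t1 j) i hz]
    exact lin (pd_differentiableAt hU hρ hz j)
      (pd_differentiableAt hU hσ hz j) i
  have hH : ∀ i j, hess g (fun w => Real.exp (τ w)) z i j = Real.exp (τ z) *
      (pd i (pd j τ) z + pd i τ z * pd j τ z - pd i ρ z * pd j τ z - pd j ρ z * pd i τ z +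
        if i = j then pd 0 ρ z * pd 0 τ z + pd 1 ρ z * pd 1 τ z else 0) := by
    intro i j
    rw [hess_conformal hU hg hz (hd hρ z hz)]
    simp only [pd_pd_exp hU hτ hz, pd_exp (hd hτ z hz)]
    split_ifs <;> ring
  have hE := Real.exp_pos (τ z)
  refine smul_one_le_of_norm_le ?_ ?_
  · rw [hH, hH, pd_comm hU hτ hz 1 0]
    simp
    ring
  -- Substituting σ = ρ - 2τ turns the Christoffel terms ρ_i τ_j into the difference of the squared
  -- gradients in the two Schwarzians, up to the square of τ_x - iτ_y.
  · have e : ((hess g (fun w => Real.exp (τ w)) z 0 0 - hess g (fun w => Real.exp (τ w)) z 1 1 : ℝ)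
          : ℂ) - ((2 * hess g (fun w => Real.exp (τ w)) z 0 1 : ℝ) : ℂ) * Complex.I =
        (Real.exp (τ z) : ℂ) * (schwarzPd ρ z - schwarzPd σ z -
          ((pd 0 τ z : ℂ) - (pd 1 τ z : ℂ) * Complex.I) ^ 2) := by
      rw [hH, hH, hH, schwarzPd, schwarzPd]
      simp only [t2, t1 _ hz]
      apply Complex.ext <;> simp [sq] <;> ring
    have n1 : ‖((pd 0 τ z : ℂ) - (pd 1 τ z : ℂ) * Complex.I) ^ 2‖ =
        pd 0 τ z ^ 2 + pd 1 τ z ^ 2 := by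
      rw [norm_pow, Complex.sq_norm, Complex.normSq_apply]; simp; ring
    rw [e, norm_mul, Complex.norm_real, Real.norm_of_nonneg hE.le, hH, hH]
    have n2 := norm_sub_le (schwarzPd ρ z - schwarzPd σ z)
      (((pd 0 τ z : ℂ) - (pd 1 τ z : ℂ) * Complex.I) ^ 2)
    rw [n1] at n2
    -- The Christoffel terms cancel in the trace, leaving e^τ (Δτ + |∇τ|²). Its |∇τ|² compensates
    -- exactly for the square split off by the triangle inequality.
    have n3 := mul_le_mul_of_nonneg_left (n2.trans (show _ ≤ (pd 0 (pd 0 ρ) z + pd 1 (pd 1 ρ) z) / 2 -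
      (pd 0 (pd 0 σ) z + pd 1 (pd 1 σ) z) / 2 - 2 * β + (pd 0 τ z ^ 2 + pd 1 τ z ^ 2) by
        linarith)) hE.le
    refine n3.trans (le_of_eq ?_)
    simp only [t2, if_true]
    ring

end Hessian

/-! ### The conformal factor of a holomorphic curve -/

theorem norm_deriv_eq_exp_sigma {n : ℕ} {φ : ℂ → EuclideanSpace ℂ (Fin n)} {z : ℂ}
    (h : deriv φ z ≠ 0) : ‖deriv φ z‖ = Real.exp (sigma φ z) := by
  have h1 := norm_pos_iff.2 h
  rw [sigma, ← EuclideanSpace.norm_sq_eq, Real.log_pow]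
  rw [show (1 / 2 : ℝ) * ((2 : ℕ) * Real.log ‖deriv φ z‖) = Real.log ‖deriv φ z‖ by
    push_cast; ring, Real.exp_log h1]

theorem contDiffOn_sigma {n : ℕ} {φ : ℂ → EuclideanSpace ℂ (Fin n)} {U : Set ℂ} (hU : IsOpen U)
    (hφ : DifferentiableOn ℂ φ U) (hφ' : ∀ z ∈ U, deriv φ z ≠ 0) :
    ContDiffOn ℝ 2 (sigma φ) U := by
  have h1 : ContDiffOn ℝ 2 (deriv φ) U := ((hφ.deriv hU).contDiffOn hU).restrict_scalars ℝ
  have h2 : ContDiffOn ℝ 2 (fun z => ∑ k, ‖deriv φ z k‖ ^ 2) U := by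
    refine ContDiffOn.sum fun k _ => ContDiffOn.norm_sq ℝ ?_
    exact ((EuclideanSpace.proj (𝕜 := ℂ) k).restrictScalars ℝ).contDiff.comp_contDiffOn h1
  refine contDiffOn_const.mul (h2.log fun z hz => ?_)
  rw [← EuclideanSpace.norm_sq_eq]
  exact pow_ne_zero 2 (norm_ne_zero_iff.2 (hφ' z hz))

/-! ### The radial metric of an extremal Nehari function -/

section Nehari

variable {p u : ℝ → ℝ}

theorem IsNehari.deriv_extremalFun (hp : IsNehari p) (hu : IsInitialSolution p u) {x : ℝ}
    (hx : x ∈ Ioo (-1 : ℝ) 1) : deriv (extremalFun u) x = Real.exp (-2 * Real.log (u x)) := by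
  have hcont : ContinuousOn (fun t => (u t ^ 2)⁻¹) (Ioo (-1) 1) := fun t ht =>
    (((hu.1 t ht).1.continuousAt.pow 2).inv₀
      (pow_ne_zero 2 (hp.initial_pos hu t ht).ne')).continuousWithinAt
  have hsub : uIcc 0 x ⊆ Ioo (-1 : ℝ) 1 := ordConnected_Ioo.uIcc_subset (by norm_num) hx
  have h := intervalIntegral.integral_hasDerivAt_right
    (hcont.mono hsub).intervalIntegrable
    (hcont.stronglyMeasurableAtFilter isOpen_Ioo x hx)
    (hcont.continuousAt (isOpen_Ioo.mem_nhds hx))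
  have h0 := hp.initial_pos hu x hx
  rw [show deriv (extremalFun u) x = (u x ^ 2)⁻¹ from h.deriv,
    show -2 * Real.log (u x) = -(Real.log (u x) + Real.log (u x)) by ring, Real.exp_neg,
    Real.exp_add, Real.exp_log h0, sq]

/-- Here `radial_partials` is applied with R' = 2y and R'' = 2(p + y²). Describing κ and l by
relations without denominators lets the origin, where κ = 2p(0), be treated together with the
punctured disk. -/
theorem IsNehari.neg_log_partials (hp : IsNehari p) (hu : IsInitialSolution p u) :
    ContDiffOn ℝ 2 (fun z : ℂ => -2 * Real.log (u ‖z‖)) (ball 0 1) ∧ ∀ z ∈ ball (0 : ℂ) 1,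
      ∃ κ l : ℝ, (‖z‖ ≠ 0 → κ = 2 * riccati u ‖z‖ / ‖z‖) ∧ (‖z‖ = 0 → κ = 2 * p 0) ∧
      l * ‖z‖ ^ 2 = 2 * (p ‖z‖ + riccati u ‖z‖ ^ 2) - κ ∧
      κ * ‖z‖ = 2 * riccati u ‖z‖ ∧
      pd 0 (fun z : ℂ => -2 * Real.log (u ‖z‖)) z = κ * z.re ∧
      pd 1 (fun z : ℂ => -2 * Real.log (u ‖z‖)) z = κ * z.im ∧
      pd 0 (pd 0 (fun z : ℂ => -2 * Real.log (u ‖z‖))) z = l * z.re ^ 2 + κ ∧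
      pd 0 (pd 1 (fun z : ℂ => -2 * Real.log (u ‖z‖))) z = l * (z.re * z.im) ∧
      pd 1 (pd 1 (fun z : ℂ => -2 * Real.log (u ‖z‖))) z = l * z.im ^ 2 + κ := by
  have hI : ∀ r ∈ Ico (0 : ℝ) 1, r ∈ Ioo (-1 : ℝ) 1 := fun r hr => ⟨by linarith [hr.1], hr.2⟩
  obtain ⟨h1, h2⟩ := radial_partials (R := fun r => -2 * Real.log (u r))
    (R' := fun r => 2 * riccati u r) (R'' := fun r => 2 * (p r + riccati u r ^ 2))
    (by simp [hu.riccati_zero])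
    (fun r hr => (((hu.1 r (hI r hr)).1.log (hp.initial_pos hu r (hI r hr)).ne').const_mul
      (-2)).congr_deriv (by simp [riccati]))
    (fun r hr => (hp.hasDerivAt_riccati hu (hI r hr)).const_mul 2)
    (fun r hr => ((hp.cont.continuousAt (isOpen_Ioo.mem_nhds (hI r hr))).add
      ((hp.hasDerivAt_riccati hu (hI r hr)).continuousAt.pow 2)).const_mul 2)
  refine ⟨h1, fun z hz => ⟨_, _, ?_, ?_, ?_, ?_, h2 z hz⟩⟩
  · intro h; simp only [radialQuot, if_neg h]
  · intro h; simp [radialQuot, h, hu.riccati_zero]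
  · by_cases h : ‖z‖ = 0
    · simp [h, radialQuot]
    · field_simp
  · by_cases h : ‖z‖ = 0
    · simp [h, hu.riccati_zero]
    · simp only [radialQuot, if_neg h]; field_simp

/-- The triangle inequality comparing a Schwarzian bounded by `2p` with the radial Schwarzian. -/
theorem IsExtremalNehari.schwarz_compare (hp : IsExtremalNehari p) (hu : IsInitialSolution p u)
    {z : ℂ} (hz : z ∈ ball (0 : ℂ) 1) (S : ℂ) {b : ℝ} (h : ‖S‖ + b ≤ 2 * p ‖z‖) :
    ‖schwarzPd (fun z : ℂ => -2 * Real.log (u ‖z‖)) z - S‖ + b ≤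
      (pd 0 (pd 0 fun z : ℂ => -2 * Real.log (u ‖z‖)) z +
        pd 1 (pd 1 fun z : ℂ => -2 * Real.log (u ‖z‖)) z) / 2 := by
  obtain ⟨κ, l, hκ, hκ0, hl, hκr, d0, d1, d00, d01, d11⟩ := (hp.1.neg_log_partials hu).2 z hz
  have hz1 : ‖z‖ < 1 := by simpa using hz
  have hr2 : ‖z‖ ^ 2 = z.re ^ 2 + z.im ^ 2 := by
    rw [Complex.sq_norm, Complex.normSq_apply]; ring
  have hA : p ‖z‖ ≤ riccati u ‖z‖ ^ 2 + κ / 2 := by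
    by_cases h0 : ‖z‖ = 0
    · rw [hκ0 h0, h0, hu.riccati_zero]; linarith
    · have := hp.le_riccati hu ⟨(norm_nonneg z).lt_of_ne' h0, hz1⟩
      rw [hκ h0]
      linarith [show 2 * riccati u ‖z‖ / ‖z‖ / 2 = riccati u ‖z‖ / ‖z‖ by ring]
  have e : schwarzPd (fun z : ℂ => -2 * Real.log (u ‖z‖)) z =
      (((l - κ ^ 2) / 2 : ℝ) : ℂ) * (starRingEnd ℂ z) ^ 2 := by
    rw [schwarzPd, d0, d1, d00, d01, d11]
    apply Complex.ext <;> simp [sq] <;> ring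
  -- By `hA` the modulus opens with this sign. Since Δρ/2 = y² + κ/2 + p, adding the bound 2p gives
  -- exactly Δρ/2.
  have n : ‖schwarzPd (fun z : ℂ => -2 * Real.log (u ‖z‖)) z‖ =
      riccati u ‖z‖ ^ 2 + κ / 2 - p ‖z‖ := by
    rw [e, norm_mul, norm_pow, Complex.norm_conj, Complex.norm_real, Real.norm_eq_abs,
      ← abs_of_nonneg (sq_nonneg ‖z‖), ← abs_mul, ← abs_neg, ← abs_of_nonneg (sub_nonneg.2 hA)]
    congr 1
    linear_combination (-1 / 2) * hl + (1 / 2) * (κ * ‖z‖ + 2 * riccati u ‖z‖) * hκr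
  have := norm_sub_le (schwarzPd (fun z : ℂ => -2 * Real.log (u ‖z‖)) z) S
  rw [n] at this
  rw [hr2] at hl
  rw [d00, d11]
  linarith

end Nehari

end HolCurve

/-! ### Conclusion: convexity of w -/

theorem theorem5 {n : ℕ} (φ : ℂ → EuclideanSpace ℂ (Fin n)) (p u₀ : ℝ → ℝ)
    (hφ : DifferentiableOn ℂ φ (ball 0 1))
    (hφ' : ∀ z ∈ ball (0 : ℂ) 1, deriv φ z ≠ 0)
    (hp : HolCurve.IsExtremalNehari p)
    (hu₀ : HolCurve.IsInitialSolution p u₀)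
    (hcrit : HolCurve.SatisfiesCriterion φ p) :
    ContDiffOn ℝ 2 (HolCurve.wFun (HolCurve.extremalFun u₀) φ) (ball 0 1) ∧
    (∀ z ∈ ball (0 : ℂ) 1,
      ((1 / 8) * HolCurve.wFun (HolCurve.extremalFun u₀) φ z ^ (-3 : ℤ) *
          |HolCurve.gaussCurv φ z|) • HolCurve.radialMetric (HolCurve.extremalFun u₀) z ≤
        HolCurve.hess (HolCurve.radialMetric (HolCurve.extremalFun u₀))
          (HolCurve.wFun (HolCurve.extremalFun u₀) φ) z) ∧
    HolCurve.ConvexRel (HolCurve.radialMetric (HolCurve.extremalFun u₀))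
      (HolCurve.wFun (HolCurve.extremalFun u₀) φ) (ball 0 1) := by
  open HolCurve in
  set ρ : ℂ → ℝ := fun z => -2 * Real.log (u₀ ‖z‖) with hρdef
  have hσ := contDiffOn_sigma isOpen_ball hφ hφ'
  have hρ : ContDiffOn ℝ 2 ρ (ball 0 1) := (hp.1.neg_log_partials hu₀).1
  have hΦ : ∀ z ∈ ball (0 : ℂ) 1, deriv (extremalFun u₀) ‖z‖ = Real.exp (ρ z) := fun z hz =>
    hp.1.deriv_extremalFun hu₀ ⟨by linarith [norm_nonneg z], by simpa using hz⟩
  have hw : EqOn (wFun (extremalFun u₀) φ) (fun z => Real.exp ((ρ z - sigma φ z) / 2))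
      (ball 0 1) := fun z hz => by
    simp only [wFun]
    rw [hΦ z hz, norm_deriv_eq_exp_sigma (hφ' z hz), ← Real.exp_sub, Real.exp_half]
  have hg : ∀ z ∈ ball (0 : ℂ) 1, radialMetric (extremalFun u₀) z =
      Real.exp (2 * ρ z) • (1 : Matrix (Fin 2) (Fin 2) ℝ) := fun z hz => by
    rw [radialMetric, hΦ z hz, sq, ← Real.exp_add, two_mul]
  have hC2 : ContDiffOn ℝ 2 (wFun (extremalFun u₀) φ) (ball 0 1) :=
    (((hρ.sub hσ).div_const 2).exp).congr hw
  have hmain : ∀ z ∈ ball (0 : ℂ) 1,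
      ((1 / 8) * wFun (extremalFun u₀) φ z ^ (-3 : ℤ) * |gaussCurv φ z|) •
        radialMetric (extremalFun u₀) z ≤
      hess (radialMetric (extremalFun u₀)) (wFun (extremalFun u₀) φ) z := by
    intro z hz
    have hK : |gaussCurv φ z| =
        Real.exp (-2 * sigma φ z) * |Laplacian.laplacian (sigma φ) z| := by
      rw [gaussCurv, abs_mul, abs_neg, abs_of_pos (Real.exp_pos _)]
    have hL := laplacian_eq_pd isOpen_ball hσ hz
    set D := Laplacian.laplacian (sigma φ) z
    have hc := hcrit z hz
    rw [schwarzian_eq isOpen_ball hσ hz, hK, norm_deriv_eq_exp_sigma (hφ' z hz)] at hc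
    have e1 : Real.exp (sigma φ z) ^ 2 * Real.exp (-2 * sigma φ z) = 1 := by
      rw [sq, ← Real.exp_add, ← Real.exp_add, ← Real.exp_zero]; congr 1; ring
    have e2 : 3 / 4 * Real.exp (sigma φ z) ^ 2 * (Real.exp (-2 * sigma φ z) * |D|) =
        3 / 4 * |D| := by linear_combination 3 / 4 * |D| * e1
    rw [e2] at hc
    have h1 := hp.schwarz_compare hu₀ hz _ hc
    -- Of the 3/4 |Δσ| supplied by the criterion, 1/2 absorbs Δσ/2 whatever its sign. The remaining
    -- 1/4 equals 2β, whence β = |Δσ|/8.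
    have h2 := le_hess_exp isOpen_ball hg hρ hσ hz (β := |D| / 8) (by
      rw [← hL]
      linarith [le_abs_self D])
    rw [hess_congr isOpen_ball hw hz, hg z hz, smul_smul, hw hz, hK]
    refine (le_of_eq ?_).trans h2
    congr 1
    -- This is w⁴ = e^{2ρ-2σ}: the factor e^{-2σ} comes from the curvature and e^{2ρ} from the
    -- metric.
    have e3 : Real.exp ((ρ z - sigma φ z) / 2) ^ (-3 : ℤ) * Real.exp (-2 * sigma φ z) *
        Real.exp (2 * ρ z) = Real.exp ((ρ z - sigma φ z) / 2) := by
      rw [zpow_neg, zpow_ofNat, ← Real.exp_nat_mul, ← Real.exp_neg, ← Real.exp_add,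
        ← Real.exp_add]
      congr 1
      push_cast
      ring
    linear_combination |D| / 8 * e3
  refine ⟨hC2, hmain, hC2, fun z => (1 / 8) * wFun (extremalFun u₀) φ z ^ (-3 : ℤ) *
    |gaussCurv φ z|, fun z hz => ⟨?_, hmain z hz⟩⟩
  have : 0 ≤ wFun (extremalFun u₀) φ z := Real.sqrt_nonneg _
  positivity
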